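/- \textbf{Theorem (Semilinearity).} Let $\mathbb{N}_\infty=\mathbb{N}\cup\{\infty\}$. An $\mathbb{N}$-CRA $\mathcal C$ (cost register automaton) of dimension $k$ over a finite alphabet $A$ is a deterministic finite automaton with a total transition function, together with $k$ registers $r_1,\dots,r_k$ taking values in $\mathbb{N}_\infty$, a vector of initial register values in $\mathbb{N}_\infty^k$, for each transition a simultaneous update $$r_i \leftarrow \min\{r_1+m_{1,i},\ \dots,\ r_k+m_{k,i},\ m_{k+1,i}\}\qquad(1\le i\le k)$$ with all $m_{j,i}\in\mathbb{N}_\infty$, and for each accepting state an output expression $\min\{r_1+m_1,\dots,r_k+m_k,m_{k+1}\}$ with all $m_j\in\mathbb{N}_\infty$. The value $\mathcal C(w)$ of a word $w\in A^*$ is $\infty$ if $w$ is not accepted; otherwise it is the output expression of the state reached by $w$, evaluated on the registers after the updates along the run on $w$. $\mathcal C$ is copyless if, in every update and for every $i\in\{1,\dots,k\}$, at most one $j\in\{1,\dots,k\}$ satisfies $m_{i,j}\neq\infty$. Then the following problem is undecidable. \emph{Given:} a finite alphabet $A$ and a copyless $\mathbb{N}$-CRA $\mathcal C$ over $A$. \emph{Question:}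 is the set $\mathcal C(A^*)\cap\mathbb{N}$ of finite values of $\mathcal C$ semilinear, i.e. eventually periodic? -/

import Mathlib

/-- An expression `min {r₁ + m₁, …, r_k + m_k, m_{k+1}}` over the registers `r₁, …, r_k`,
with all `mᵢ` in `ℕ ∪ {∞}`. -/
structure MinExpr (k : ℕ) where
  /-- The increments `m₁, …, m_k`; the value `⊤` makes the register irrelevant. -/
  coeff : Fin k → ℕ∞
  /-- The constant term `m_{k+1}`. -/
  const : ℕ∞

namespace MinExpr

/-- The value of the expression on given register contents (the empty minimum is `⊤`). -/
noncomputable def eval {k : ℕ} (e : MinExpr k) (r : Fin k → ℕ∞) : ℕ∞ :=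
  (Finset.univ.inf fun i => r i + e.coeff i) ⊓ e.const

end MinExpr

/-- A cost register automaton over `ℕ ∪ {∞}` of dimension `k` with input alphabet `A` and set of
states `Q`: a deterministic automaton with `k` registers updated by min-plus expressions. -/
structure NatCRA (A Q : Type) (k : ℕ) extends DFA A Q where
  /-- The initial values of the registers. -/
  init : Fin k → ℕ∞
  /-- `update q a j` is the expression assigned to register `j` by the transition reading `a`
  in state `q`. -/
  update : Q → A → Fin k → MinExpr k
  /-- The output expressions; only those at accepting states play a role. -/
  output : Q → MinExpr k

namespace NatCRA

variable {A Q : Type} {k : ℕ}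

/-- One step on configurations (state, register contents); all registers are updated
simultaneously. -/
noncomputable def next (C : NatCRA A Q k) (c : Q × (Fin k → ℕ∞)) (a : A) : Q × (Fin k → ℕ∞) :=
  (C.step c.1 a, fun j => (C.update c.1 a j).eval c.2)

/-- The configuration reached after reading the word `w`. -/
noncomputable def config (C : NatCRA A Q k) (w : List A) : Q × (Fin k → ℕ∞) :=
  w.foldl C.next (C.start, C.init)

open Classical in
/-- The value of the automaton on `w`: the output at the state reached if `w` is accepted, and
`∞` otherwise. -/
noncomputable def value (C : NatCRA A Q k) (w : List A) : ℕ∞ :=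
  if (C.config w).1 ∈ C.accept then (C.output (C.config w).1).eval (C.config w).2 else ⊤

/-- The image `C(A*)`, as a set of natural numbers (the value `∞` is disregarded). -/
def image (C : NatCRA A Q k) : Set ℕ :=
  {v | ∃ w : List A, C.value w = (v : ℕ∞)}

/-- In every update function, each register occurs with a non-`∞` increment in the expression of
at most one register. The output expressions are not restricted. -/
def Copyless (C : NatCRA A Q k) : Prop :=
  ∀ (q : Q) (a : A) (i : Fin k), {j : Fin k | (C.update q a j).coeff i ≠ ⊤}.Subsingleton

end NatCRA

/-! ### Machines as finite objects, given to an algorithm by listing their tables -/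

/-- An element of `ℕ ∪ {∞}` as finite data. -/
def weightCode (x : ℕ∞) : Option ℕ :=
  ENat.recTopCoe (C := fun _ => Option ℕ) none some x

/-- The list of increments and the constant term. -/
abbrev MinExprCode : Type := List (Option ℕ) × Option ℕ

/-- The finite description of an expression. -/
def MinExpr.code {k : ℕ} (e : MinExpr k) : MinExprCode :=
  (List.ofFn fun i => weightCode (e.coeff i), weightCode e.const)

/-- Descriptions of cost register automata: the sizes of the alphabet, of the state set and of the
register set; the initial state; the initial register values; for each state and each letter, the
target state and the list of register updates; and for each state, either its output expression
or `none` if the state is not accepting. -/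
abbrev NatCRACode : Type :=
  (ℕ × ℕ × ℕ) × ℕ × List (Option ℕ) × List (List (ℕ × List MinExprCode)) ×
    List (Option MinExprCode)

open Classical in
/-- The description of an automaton with alphabet `{0, …, m-1}` and states `{0, …, n-1}`. -/
noncomputable def NatCRA.code {m n k : ℕ} (C : NatCRA (Fin m) (Fin n) k) : NatCRACode :=
  ((m, n, k), (C.start : ℕ), List.ofFn fun i => weightCode (C.init i),
    List.ofFn fun q => List.ofFn fun a =>
      ((C.step q a : ℕ), List.ofFn fun j => (C.update q a j).code),
    List.ofFn fun q => if q ∈ C.accept then some (C.output q).code else none)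

/-!
Halting of a fixed universal program is reduced to semilinearity of the image of an automaton that
depends on the input of the program only through its initial register values.

**Stack machines are linear.** Contents of stacks are encoded as numbers in base `5`, so that
pushing and popping are affine maps. A further coordinate, the scale, is multiplied by `11` in each
step and all stack coordinates are kept multiplied by it; then each step is an injective linear map
of vectors of natural numbers, which at least doubles the sum of the coordinates, and which map it
is depends on the control state and on residues modulo `5` (`LinearMachine.ofStack`,
`LinearMachine.respects_stack`).

**Copyless automata check runs of linear machines.** A run `V₀, V₁, …` is written as a word whose
blocks contain as many letters `unit j` as the vector `Vᵢ` says. The register `main` accumulates a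
cost; since vectors grow fast enough, the cost can be arranged to be `c * ∑ Vᵢ` after block `i`
of a correct run. A step from `V` to `V'` is correct iff finitely many inequalities
"the cost so far is at most a linear form with nonnegative coefficients in `V` and `V'`" hold
(`LinearMachine.tests_iff`). The right-hand sides only involve the last two blocks and are computed
by registers started from a constant at the beginning of the previous block. Taking the minimum
of `main` and these registers at the end of each block, with the cost being odd and the tests being
even, keeps `main` odd exactly as long as all steps are correct; nothing has to be copied.
With a sink state that produces all even numbers, the image is the set of the even numbers together
with the odd numbers `2 * (c * ∑ V) + 1` for the vectors `V` on the run (`LinearMachine.image_cra`).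

**Halting.** If the run is finite, the image differs from the set of even numbers by a finite set.
Otherwise its odd elements grow exponentially, and it is not ultimately periodic
(`LinearMachine.isSemilinearSet_image_cra`).

The stack machines to which this is applied are those that Mathlib constructs for partial recursive
functions. The initial registers, and hence the description of the automaton, are primitive
recursive in the input (`primrec_encodeStack_trList`, `NatCRA.computable_code_init`).
-/

open Matrix

/-! ### Min-plus expressions and automata over arbitrary index types -/

/-- A min-plus expression over registers named by a type `R`, transported to numbered registers
along `e : R ≃ Fin k`. -/
def MinExpr.ofReg {R : Type} {k : ℕ} (e : R ≃ Fin k) (coeff : R → ℕ∞) (const : ℕ∞) : MinExpr k :=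
  ⟨fun i => coeff (e.symm i), const⟩

namespace MinExpr

variable {R : Type} [Fintype R] {k : ℕ} (e : R ≃ Fin k) (r : Fin k → ℕ∞)

theorem eval_ofReg (coeff : R → ℕ∞) (const : ℕ∞) :
    (ofReg e coeff const).eval r = (Finset.univ.inf fun i => r (e i) + coeff i) ⊓ const := by
  unfold eval ofReg
  congr 1
  rw [← Finset.map_univ_equiv e, Finset.inf_map]
  simp [Function.comp_def]

theorem eval_ofReg_single [DecidableEq R] (i : R) (w : ℕ∞) :
    (ofReg e (fun i' => if i' = i then w else ⊤) ⊤).eval r = r (e i) + w := by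
  rw [eval_ofReg, inf_top_eq]
  apply le_antisymm
  · simpa using Finset.inf_le (f := fun i' => r (e i') + if i' = i then w else ⊤)
      (Finset.mem_univ i)
  · refine Finset.le_inf fun i' _ => ?_
    by_cases h : i' = i <;> simp [h]

theorem eval_ofReg_const (v : ℕ∞) : (ofReg e (fun _ => ⊤) v).eval r = v := by
  rw [eval_ofReg]
  simp

/-- The minimum of the registers in a set `p` is a lower bound attained at one of them. -/
theorem eval_ofReg_min (p : R → Prop) [DecidablePred p] (hp : ∃ i, p i) :
    (∀ i, p i → (ofReg e (fun i => if p i then 0 else ⊤) ⊤).eval r ≤ r (e i)) ∧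
      ∃ i, p i ∧ (ofReg e (fun i => if p i then 0 else ⊤) ⊤).eval r = r (e i) := by
  rw [eval_ofReg, inf_top_eq]
  have hle : ∀ i, p i →
      (Finset.univ.inf fun i => r (e i) + if p i then 0 else ⊤) ≤ r (e i) := fun i hi => by
    simpa [hi] using Finset.inf_le (f := fun i => r (e i) + if p i then 0 else ⊤)
      (Finset.mem_univ i)
  refine ⟨hle, ?_⟩
  obtain ⟨i₀, h₀⟩ := hp
  obtain ⟨i, -, hi⟩ := Finset.exists_mem_eq_inf Finset.univ ⟨i₀, Finset.mem_univ i₀⟩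
    fun i => r (e i) + if p i then 0 else ⊤
  by_cases h : p i
  · exact ⟨i, h, by simpa [h] using hi⟩
  · refine ⟨i₀, h₀, le_antisymm (hle i₀ h₀) ?_⟩
    rw [hi]
    simp [h]

end MinExpr

namespace NatCRA

variable {A A' Q Q' : Type} {k : ℕ}

/-- Renaming of the letters and the states of an automaton. -/
def reindex (f : A ≃ A') (g : Q ≃ Q') (C : NatCRA A Q k) : NatCRA A' Q' k where
  step q a := g (C.step (g.symm q) (f.symm a))
  start := g C.start
  accept := g.symm ⁻¹' C.accept
  init := C.init
  update q a := C.update (g.symm q) (f.symm a)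
  output q := C.output (g.symm q)

theorem config_append_singleton (C : NatCRA A Q k) (w : List A) (a : A) :
    C.config (w ++ [a]) = C.next (C.config w) a := by
  simp [config]

theorem config_reindex (f : A ≃ A') (g : Q ≃ Q') (C : NatCRA A Q k) (w : List A) :
    (C.reindex f g).config (w.map f) = (g (C.config w).1, (C.config w).2) := by
  induction w using List.reverseRecOn with
  | nil => rfl
  | append_singleton w a ih =>
    rw [List.map_append, List.map_singleton, config_append_singleton, ih,
      config_append_singleton]
    simp [next, reindex]

theorem value_reindex (f : A ≃ A') (g : Q ≃ Q') (C : NatCRA A Q k) (w : List A) :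
    (C.reindex f g).value (w.map f) = C.value w := by
  have h : ((C.reindex f g).config (w.map f)).1 ∈ (C.reindex f g).accept ↔
      (C.config w).1 ∈ C.accept := by
    rw [config_reindex]
    simp [reindex]
  unfold value
  by_cases hw : (C.config w).1 ∈ C.accept
  · rw [if_pos hw, if_pos (h.2 hw), config_reindex]
    simp [reindex]
  · rw [if_neg hw, if_neg (mt h.1 hw)]

theorem image_reindex (f : A ≃ A') (g : Q ≃ Q') (C : NatCRA A Q k) :
    (C.reindex f g).image = C.image := by
  ext v
  constructor
  · rintro ⟨w, hw⟩
    refine ⟨w.map f.symm, ?_⟩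
    rw [← hw, ← value_reindex f g]
    simp
  · rintro ⟨w, hw⟩
    exact ⟨w.map f, by rw [value_reindex, hw]⟩

theorem Copyless.reindex {C : NatCRA A Q k} (h : C.Copyless) (f : A ≃ A') (g : Q ≃ Q') :
    (C.reindex f g).Copyless :=
  fun _ _ i => h _ _ i

/-- The description of an automaton depends computably on its initial register values. -/
theorem computable_code_init {m n : ℕ} (C : ℕ → NatCRA (Fin m) (Fin n) k) (v : Fin k → ℕ → ℕ)
    (hv : ∀ i, Primrec (v i))
    (hC : ∀ x, C x = { C 0 with init := fun i => (v i x : ℕ∞) }) :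
    Computable fun x => (C x).code := by
  have h : ∀ x, (C x).code = ((m, n, k), ((C 0).start : ℕ), (List.ofFn fun i => some (v i x)),
      (C 0).code.2.2.2) := fun x => by
    rw [hC x]
    rfl
  exact (Primrec.pair (.const _) (.pair (.const _) (.pair
    (Primrec.list_ofFn fun i => Primrec.option_some.comp (hv i))
    (.const _)))).to_comp.of_eq fun x => (h x).symm

end NatCRA

/-! ### Linear machines -/

/-- A machine with finite control `S` acting on vectors of natural numbers indexed by `J`. The
control state `s'` that follows `s` is determined by `s` and the residues modulo `m` of the vector
`V`; on entering `s'` the vector becomes the solution `V'` of `c • V = mat s' *ᵥ V'`, and the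
machine is stuck if there is none. -/
structure LinearMachine (S J : Type) [Fintype J] (c m : ℕ) where
  /-- `c` times the inverse of the linear map applied on entering a control state. -/
  mat : S → Matrix J J ℤ
  /-- The next control state, or `none` if the machine halts. -/
  next : S → (J → ZMod m) → Option S
  /-- The vector on entering a control state is determined by the previous one. -/
  mat_injective : ∀ s, Function.Injective (mat s *ᵥ ·)
  /-- The weights of the tests below are nonnegative. -/
  abs_mat_add_le : ∀ s i j, |mat s j i| + ∑ l, mat s l i ≤ c
  /-- The sum of the coordinates at least doubles in each step. -/
  two_mul_sum_mat_le : ∀ s i, 2 * ∑ l, mat s l i ≤ c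

namespace LinearMachine

variable {S J : Type} [Fintype J] {c m : ℕ} (M : LinearMachine S J c m)

/-- The residues of a vector. -/
def residues (m : ℕ) (V : J → ℕ) : J → ZMod m := fun j => V j

/-- `V'` is the vector obtained from `V` on entering the control state `s`. -/
def Enters (s : S) (V V' : J → ℕ) : Prop :=
  ∀ j, (c : ℤ) * V j = (M.mat s *ᵥ fun i => (V' i : ℤ)) j

/-- One step of a linear machine. -/
def Step (x y : S × (J → ℕ)) : Prop :=
  M.next x.1 (residues m x.2) = some y.1 ∧ M.Enters y.1 x.2 y.2

variable {M}

theorem Enters.unique {s : S} {V V₁ V₂ : J → ℕ} (h₁ : M.Enters s V V₁) (h₂ : M.Enters s V V₂) :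
    V₁ = V₂ := by
  have h := M.mat_injective s (funext fun j => (h₁ j).symm.trans (h₂ j))
  funext j
  exact_mod_cast congrFun h j

theorem Step.unique {x y z : S × (J → ℕ)} (hy : M.Step x y) (hz : M.Step x z) : y = z := by
  obtain ⟨s, V⟩ := y
  obtain ⟨s', V'⟩ := z
  obtain rfl : s = s' := Option.some.inj (hy.1.symm.trans hz.1)
  rw [show V = V' from hy.2.unique hz.2]

theorem Enters.mul_sum {s : S} {V V' : J → ℕ} (h : M.Enters s V V') :
    (c : ℤ) * ∑ j, (V j : ℤ) = ∑ i, (∑ j, M.mat s j i) * V' i := by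
  rw [Finset.mul_sum, Finset.sum_congr rfl fun j _ => h j]
  simp only [mulVec, dotProduct, Finset.sum_mul]
  exact Finset.sum_comm

theorem Enters.two_mul_sum_le {s : S} {V V' : J → ℕ} (hc : 0 < c) (h : M.Enters s V V') :
    2 * ∑ j, V j ≤ ∑ j, V' j := by
  have h1 := h.mul_sum
  have h2 : 2 * ∑ i, (∑ j, M.mat s j i) * (V' i : ℤ) ≤ c * ∑ i, (V' i : ℤ) := by
    rw [Finset.mul_sum, Finset.mul_sum]
    refine Finset.sum_le_sum fun i _ => ?_
    rw [← mul_assoc]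
    exact mul_le_mul_of_nonneg_right (M.two_mul_sum_mat_le s i) (by positivity)
  have h3 : (c : ℤ) * (2 * ∑ j, (V j : ℤ)) ≤ c * ∑ i, (V' i : ℤ) := by linarith
  have h4 := le_of_mul_le_mul_left h3 (by exact_mod_cast hc)
  exact_mod_cast h4

/-! ### Linear tests for a step -/

variable (M)

/-- The weight of coordinate `i` of the new vector in the total cost of a word: it makes the
total grow from `c * ∑ V` to `c * ∑ V'` when the new vector `V'` is right. -/
def gain (s : S) (i : J) : ℕ := ((c : ℤ) - ∑ l, M.mat s l i).toNat

open Classical in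
/-- The weights of the old vector in the test `t`. The test `(j, b)` bounds the error in
coordinate `j` from one side. -/
noncomputable def oldWeight (c : ℕ) (t : J × Bool) (i : J) : ℕ :=
  if i = t.1 then cond t.2 (2 * c) 0 else c

/-- The weights of the new vector in the test `t`. -/
def newWeight (s : S) (t : J × Bool) (i : J) : ℕ :=
  ((c : ℤ) - ∑ l, M.mat s l i - cond t.2 (M.mat s t.1 i) (-M.mat s t.1 i)).toNat

theorem coe_gain (s : S) (i : J) : (M.gain s i : ℤ) = c - ∑ l, M.mat s l i := by
  have := M.abs_mat_add_le s i i
  have := abs_nonneg (M.mat s i i)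
  exact Int.toNat_of_nonneg (by linarith)

theorem coe_newWeight (s : S) (t : J × Bool) (i : J) : (M.newWeight s t i : ℤ) =
    c - ∑ l, M.mat s l i - cond t.2 (M.mat s t.1 i) (-M.mat s t.1 i) := by
  have h1 := M.abs_mat_add_le s i t.1
  have h2 := le_abs_self (M.mat s t.1 i)
  have h3 := neg_le_abs (M.mat s t.1 i)
  exact Int.toNat_of_nonneg (by cases t.2 <;> simp only [cond] <;> linarith)

theorem coe_gain_dotProduct (s : S) (V' : J → ℕ) : ((M.gain s ⬝ᵥ V' : ℕ) : ℤ) =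
    c * ∑ i, (V' i : ℤ) - ∑ i, (∑ j, M.mat s j i) * V' i := by
  simp only [dotProduct, Nat.cast_sum, Nat.cast_mul, coe_gain, sub_mul, Finset.sum_sub_distrib,
    Finset.mul_sum]

theorem coe_newWeight_dotProduct (s : S) (t : J × Bool) (V' : J → ℕ) :
    ((M.newWeight s t ⬝ᵥ V' : ℕ) : ℤ) = (M.gain s ⬝ᵥ V' : ℕ) -
      cond t.2 1 (-1) * (M.mat s *ᵥ fun i => (V' i : ℤ)) t.1 := by
  simp only [dotProduct, mulVec, Nat.cast_sum, Nat.cast_mul, coe_gain, coe_newWeight,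
    Finset.mul_sum, ← Finset.sum_sub_distrib]
  refine Finset.sum_congr rfl fun i _ => ?_
  cases t.2 <;> simp only [cond] <;> ring

theorem coe_oldWeight_dotProduct (t : J × Bool) (V : J → ℕ) :
    ((oldWeight c t ⬝ᵥ V : ℕ) : ℤ) = c * ∑ i, (V i : ℤ) + cond t.2 1 (-1) * (c * V t.1) := by
  classical
  have h : ∀ i, ((oldWeight c t i * V i : ℕ) : ℤ) =
      c * V i + if i = t.1 then cond t.2 1 (-1) * (c * (V i : ℤ)) else 0 := fun i => by
    unfold oldWeight
    by_cases hi : i = t.1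
    · rw [if_pos hi, if_pos hi]
      cases t.2
      · simp
      · simp; ring
    · rw [if_neg hi, if_neg hi]
      push_cast
      ring
  simp only [dotProduct, Nat.cast_sum, h, Finset.sum_add_distrib, ← Finset.mul_sum]
  simp

variable {M}

/-- A correct step passes all tests, and only a correct step does. -/
theorem tests_iff (s : S) (V V' : J → ℕ) :
    (∀ t, c * ∑ i, V i + M.gain s ⬝ᵥ V' ≤ oldWeight c t ⬝ᵥ V + M.newWeight s t ⬝ᵥ V') ↔
      M.Enters s V V' := by
  have key : ∀ t : J × Bool,
      c * ∑ i, V i + M.gain s ⬝ᵥ V' ≤ oldWeight c t ⬝ᵥ V + M.newWeight s t ⬝ᵥ V' ↔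
        0 ≤ cond t.2 1 (-1) * ((c : ℤ) * V t.1 - (M.mat s *ᵥ fun i => (V' i : ℤ)) t.1) := by
    intro t
    rw [← Int.ofNat_le]
    push_cast [coe_oldWeight_dotProduct, coe_newWeight_dotProduct]
    constructor <;> intro h <;> linarith
  constructor
  · intro h j
    have h1 := (key (j, true)).1 (h _)
    have h2 := (key (j, false)).1 (h _)
    simp only [cond] at h1 h2
    linarith
  · intro h t
    rw [key, h t.1]
    simp

theorem Enters.mul_sum_add_gain {s : S} {V V' : J → ℕ} (h : M.Enters s V V') :
    c * ∑ i, V i + M.gain s ⬝ᵥ V' = c * ∑ i, V' i := by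
  have h1 := h.mul_sum
  have h2 := M.coe_gain_dotProduct s V'
  have h3 : ((c * ∑ i, V i + M.gain s ⬝ᵥ V' : ℕ) : ℤ) = ((c * ∑ i, V' i : ℕ) : ℤ) := by
    push_cast
    linarith
  exact_mod_cast h3

end LinearMachine

/-! ### The cost register automaton of a linear machine -/

namespace LinearMachine

/-- The letters of the automaton. A run `V₀, V₁, …` of a linear machine is written as blocks
separated by `sep`, where block `i` has as many letters `unit j` as `V i j` says. -/
inductive Letter (J : Type)
  | unit (j : J)
  | sep
  | kill
  deriving Fintype

/-- The registers: `main` holds the total cost; `old t` the test `t` of the last step, which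
started with the previous block; `cur t` the test `t` of the next step, which starts with the
current block; `idle` generates the even numbers in the sink state. -/
inductive Reg (J : Type)
  | main
  | idle
  | old (t : J × Bool)
  | cur (t : J × Bool)
  deriving Fintype, DecidableEq

variable {S J : Type} [Fintype J] {c m k : ℕ} (M : LinearMachine S J c m)

/-- The increment of a register outside the separators. In the sink state `none` only `idle`
grows; the other registers grow by twice the weights of the letter. -/
noncomputable def increment : Option (S × (J → ZMod m)) → Letter J → Reg J → ℕ
  | none, _, .idle => 2
  | some (s, _), .unit j, .main => 2 * M.gain s j
  | some (s, _), .unit j, .old t => 2 * M.newWeight s t j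
  | some _, .unit j, .cur t => 2 * oldWeight c t j
  | _, _, _ => 0

/-- The registers that are compared at the end of a block. -/
def Reg.Compared : Reg J → Prop
  | .main => True
  | .old _ => True
  | _ => False

open Classical in
/-- The expression assigned to a register. -/
noncomputable def regUpdate (e : Reg J ≃ Fin k) :
    Option (S × (J → ZMod m)) → Letter J → Reg J → MinExpr k
  | some _, .sep, .main => .ofReg e (fun i => if i.Compared then 0 else ⊤) ⊤
  | some _, .sep, .old t => .ofReg e (fun i => if i = .cur t then (0 : ℕ) else ⊤) ⊤
  | some _, .sep, .cur _ => .ofReg e (fun _ => ⊤) (2 : ℕ)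
  | q, a, r => .ofReg e (fun i => if i = r then (M.increment q a r : ℕ∞) else ⊤) ⊤

open Classical in
/-- The transitions between the control states, which record the residues of the current block.
The state `none` is a sink. -/
noncomputable def craStep :
    Option (S × (J → ZMod m)) → Letter J → Option (S × (J → ZMod m))
  | some (s, ρ), .unit j => some (s, ρ + Pi.single j 1)
  | some (s, ρ), .sep => (M.next s ρ).map fun s' => (s', 0)
  | _, _ => none

/-- The initial register values, for a first block that must satisfy `M.Enters s₀ U V₀`. -/
noncomputable def initReg (c : ℕ) (U : J → ℕ) : Reg J → ℕ
  | .main => 2 * (c * ∑ j, U j) + 1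
  | .idle => 0
  | .old t => 2 * oldWeight c t ⬝ᵥ U + 2
  | .cur _ => 2

open Classical in
/-- The automaton whose odd values are the numbers `2 * (c * ∑ V) + 1` for the vectors `V` on the
run of the linear machine that starts by entering `s₀` with the vector `U`. -/
noncomputable def cra (e : Reg J ≃ Fin k) (s₀ : S) (U : J → ℕ) :
    NatCRA (Letter J) (Option (S × (J → ZMod m))) k where
  step := M.craStep
  start := some (s₀, 0)
  accept := Set.univ
  init i := (initReg c U (e.symm i) : ℕ∞)
  update q a i := M.regUpdate e q a (e.symm i)
  output
    | none => .ofReg e (fun i => if i = .idle then (0 : ℕ) else ⊤) ⊤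
    | some _ => .ofReg e (fun i => if i.Compared then 0 else ⊤) ⊤

/-- The register to which the updates move the content of a register. -/
def Reg.dest : Option (S × (J → ZMod m)) → Letter J → Reg J → Reg J
  | some _, .sep, .old _ => .main
  | some _, .sep, .cur t => .old t
  | _, _, r => r

theorem eq_dest_of_coeff_ne_top (e : Reg J ≃ Fin k) (q : Option (S × (J → ZMod m)))
    (a : Letter J) (r : Reg J) (i : Fin k) (h : (M.regUpdate e q a r).coeff i ≠ ⊤) :
    r = Reg.dest q a (e.symm i) := by
  generalize hi : e.symm i = i' at *
  rcases q with - | ⟨s, ρ⟩ <;> cases a <;> cases r <;> cases i' <;>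
    simp_all [regUpdate, MinExpr.ofReg, Reg.dest, Reg.Compared]

theorem copyless_cra (e : Reg J ≃ Fin k) (s₀ : S) (U : J → ℕ) : (M.cra e s₀ U).Copyless := by
  intro q a i j₁ h₁ j₂ h₂
  exact e.symm.injective ((M.eq_dest_of_coeff_ne_top e q a _ i h₁).trans
    (M.eq_dest_of_coeff_ne_top e q a _ i h₂).symm)

end LinearMachine

namespace LinearMachine

variable {S J : Type} [Fintype J] {c m k : ℕ} {M : LinearMachine S J c m}
  {e : Reg J ≃ Fin k} {s₀ : S} {U : J → ℕ}

/-! ### Configurations of the automaton -/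

theorem next_cra_snd (x : Option (S × (J → ZMod m)) × (Fin k → ℕ∞)) (a : Letter J) (r : Reg J) :
    ((M.cra e s₀ U).next x a).2 (e r) = (M.regUpdate e x.1 a r).eval x.2 := by
  simp [NatCRA.next, cra]

theorem next_cra_snd_of_ne_sep (x : Option (S × (J → ZMod m)) × (Fin k → ℕ∞)) {a : Letter J}
    (r : Reg J) (h : x.1 = none ∨ a ≠ .sep) :
    ((M.cra e s₀ U).next x a).2 (e r) = x.2 (e r) + (M.increment x.1 a r : ℕ) := by
  classical
  rw [next_cra_snd, ← MinExpr.eval_ofReg_single e x.2 r]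
  congr 1
  rcases x with ⟨- | ⟨s, ρ⟩, y⟩ <;> cases a <;> cases r <;> simp [regUpdate] at h ⊢

/-- The configuration `x` has read the vector `V'` in the current block, in control state `s`, and
the tests of the last step assume that it started with the vector `V`. Nothing is said about
`main`. -/
structure Tracks (e : Reg J ≃ Fin k) (M : LinearMachine S J c m)
    (x : Option (S × (J → ZMod m)) × (Fin k → ℕ∞)) (s : S) (V V' : J → ℕ) : Prop where
  state : x.1 = some (s, residues m V')
  idle : x.2 (e .idle) = 0
  cur : ∀ t, x.2 (e (.cur t)) = ((2 * oldWeight c t ⬝ᵥ V' + 2 : ℕ) : ℕ∞)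
  old : ∀ t, x.2 (e (.old t)) =
    ((2 * (oldWeight c t ⬝ᵥ V + M.newWeight s t ⬝ᵥ V') + 2 : ℕ) : ℕ∞)

theorem residues_add_single {J : Type} [DecidableEq J] (V : J → ℕ) (j : J) :
    residues m (V + Pi.single j 1) = residues m V + Pi.single j 1 := by
  funext i
  by_cases h : i = j
  · subst h
    simp [residues]
  · simp [residues, h]

theorem Tracks.unit [DecidableEq J] {x : Option (S × (J → ZMod m)) × (Fin k → ℕ∞)} {s : S}
    {V V' : J → ℕ} (h : Tracks e M x s V V') (j : J) :
    Tracks e M ((M.cra e s₀ U).next x (.unit j)) s V (V' + Pi.single j 1) ∧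
      ((M.cra e s₀ U).next x (.unit j)).2 (e .main) = x.2 (e .main) + (2 * M.gain s j : ℕ) := by
  have key := fun r => next_cra_snd_of_ne_sep (M := M) (e := e) (s₀ := s₀) (U := U) x
    (a := .unit j) r (by simp)
  simp only [h.state] at key
  refine ⟨⟨?_, ?_, fun t => ?_, fun t => ?_⟩, key _⟩
  · rw [residues_add_single]
    simp only [NatCRA.next, cra, h.state, craStep]
    congr!
  · rw [key, h.idle]
    simp [increment]
  · rw [key, h.cur, ← Nat.cast_add, increment]
    simp only [dotProduct_add, dotProduct_single_one]
    congr 1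
    ring
  · rw [key, h.old, ← Nat.cast_add, increment]
    simp only [dotProduct_add, dotProduct_single_one]
    congr 1
    ring

theorem Tracks.sep {x : Option (S × (J → ZMod m)) × (Fin k → ℕ∞)} {s s' : S} {V V' : J → ℕ}
    (h : Tracks e M x s V V') (hs : M.next s (residues m V') = some s') :
    Tracks e M ((M.cra e s₀ U).next x .sep) s' V' 0 := by
  classical
  refine ⟨?_, ?_, fun t => ?_, fun t => ?_⟩
  · have : residues m (0 : J → ℕ) = 0 := by
      funext j
      simp [residues]
    simp only [NatCRA.next, cra, h.state, craStep, hs, this, Option.map_some]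
  · rw [next_cra_snd, h.state, ← add_zero (0 : ℕ∞), ← h.idle]
    convert MinExpr.eval_ofReg_single e x.2 .idle 0 using 2
    · simp [regUpdate, increment]
    · exact h.idle
  · rw [next_cra_snd, h.state, dotProduct_zero]
    exact MinExpr.eval_ofReg_const e x.2 _
  · rw [next_cra_snd, h.state, dotProduct_zero, add_zero, ← h.cur, ← add_zero (x.2 _)]
    convert MinExpr.eval_ofReg_single e x.2 (.cur t) 0 using 2
    simp [regUpdate]

open Classical in
/-- The comparison at the end of a block. -/
noncomputable def minCompared (e : Reg J ≃ Fin k) (y : Fin k → ℕ∞) : ℕ∞ :=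
  (MinExpr.ofReg e (fun i => if i.Compared then 0 else ⊤) ⊤).eval y

theorem minCompared_spec (e : Reg J ≃ Fin k) (y : Fin k → ℕ∞) :
    (minCompared e y = y (e .main) ∧ ∀ t, y (e .main) ≤ y (e (.old t))) ∨
      ∃ t, minCompared e y = y (e (.old t)) := by
  classical
  obtain ⟨hle, i, hi, hmin⟩ := MinExpr.eval_ofReg_min e y Reg.Compared ⟨.main, trivial⟩
  rcases i with _ | _ | t | t
  · refine .inl ⟨hmin, fun t => ?_⟩
    rw [← hmin]
    exact hle (.old t) trivial
  · exact hi.elim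
  · exact .inr ⟨t, hmin⟩
  · exact hi.elim

theorem minCompared_eq_main {e : Reg J ≃ Fin k} {y : Fin k → ℕ∞}
    (h : ∀ t, y (e .main) ≤ y (e (.old t))) : minCompared e y = y (e .main) := by
  classical
  refine le_antisymm ?_ ?_
  · exact (MinExpr.eval_ofReg_min e y Reg.Compared ⟨.main, trivial⟩).1 .main trivial
  · rcases minCompared_spec e y with h' | ⟨t, ht⟩
    · exact h'.1.ge
    · rw [ht]
      exact h t

theorem next_cra_sep_main {x : Option (S × (J → ZMod m)) × (Fin k → ℕ∞)}
    {s : S} {ρ : J → ZMod m} (h : x.1 = some (s, ρ)) :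
    ((M.cra e s₀ U).next x .sep).2 (e .main) = minCompared e x.2 := by
  rw [next_cra_snd, h]
  rfl

theorem value_cra_of_some {w : List (Letter J)} {s : S} {ρ : J → ZMod m}
    (h : ((M.cra e s₀ U).config w).1 = some (s, ρ)) :
    (M.cra e s₀ U).value w = minCompared e ((M.cra e s₀ U).config w).2 := by
  unfold NatCRA.value
  rw [if_pos (show _ ∈ (M.cra e s₀ U).accept from trivial), h]
  rfl

theorem value_cra_of_none {w : List (Letter J)} (h : ((M.cra e s₀ U).config w).1 = none) :
    (M.cra e s₀ U).value w = ((M.cra e s₀ U).config w).2 (e .idle) := by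
  classical
  unfold NatCRA.value
  rw [if_pos (show _ ∈ (M.cra e s₀ U).accept from trivial), h,
    ← add_zero (((M.cra e s₀ U).config w).2 _)]
  convert MinExpr.eval_ofReg_single e ((M.cra e s₀ U).config w).2 .idle 0 using 2
  simp only [cra, Nat.cast_zero]

/-! ### Odd values are costs of reachable vectors -/

/-- The cost of having reached the vector `V`, as a value of the automaton. -/
def cost (c : ℕ) (V : J → ℕ) : ℕ := 2 * (c * ∑ j, V j) + 1

/-- The vector `V'` occurs in the control state `s` on a run that starts by entering `s₀` with the
vector `U`. -/
inductive Reachable (M : LinearMachine S J c m) (s₀ : S) (U : J → ℕ) : S → (J → ℕ) → Prop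
  | start {V} : M.Enters s₀ U V → Reachable M s₀ U s₀ V
  | step {s V s' V'} : Reachable M s₀ U s V → M.Step (s, V) (s', V') → Reachable M s₀ U s' V'

/-- The tests are even. So if the minimum at the end of a block is odd, it is `main`, whence all
tests are passed and the step was correct. -/
theorem even_or_enters {y : Fin k → ℕ∞} {s : S} {V V' : J → ℕ}
    (hold : ∀ t, y (e (.old t)) =
      ((2 * (oldWeight c t ⬝ᵥ V + M.newWeight s t ⬝ᵥ V') + 2 : ℕ) : ℕ∞))
    (hmain : (∃ n : ℕ, y (e .main) = (2 * n : ℕ)) ∨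
      y (e .main) = (2 * (c * ∑ j, V j + M.gain s ⬝ᵥ V') + 1 : ℕ)) :
    (∃ n : ℕ, minCompared e y = (2 * n : ℕ)) ∨
      (M.Enters s V V' ∧ minCompared e y = cost c V' ∧
        y (e .main) = (2 * (c * ∑ j, V j + M.gain s ⬝ᵥ V') + 1 : ℕ)) := by
  rcases minCompared_spec e y with ⟨h, hle⟩ | ⟨t, ht⟩
  · rcases hmain with ⟨n, hn⟩ | hmain
    · exact .inl ⟨n, h.trans hn⟩
    · have hE : M.Enters s V V' := (tests_iff s V V').1 fun t => by
        have := hle t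
        rw [hmain, hold, Nat.cast_le] at this
        omega
      exact .inr ⟨hE, by rw [h, hmain, hE.mul_sum_add_gain, cost], hmain⟩
  · exact .inl ⟨oldWeight c t ⬝ᵥ V + M.newWeight s t ⬝ᵥ V' + 1, by rw [ht, hold]; congr 1⟩

/-- The invariant of all configurations of the automaton: in the sink, `idle` is even; outside the
sink, `main` is even, or it is the total cost of a run of the linear machine that ends with `V`
and continues in the control state `s`. -/
def Invariant (M : LinearMachine S J c m) (e : Reg J ≃ Fin k) (s₀ : S) (U : J → ℕ)
    (x : Option (S × (J → ZMod m)) × (Fin k → ℕ∞)) : Prop :=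
  (x.1 = none ∧ ∃ n : ℕ, x.2 (e .idle) = (2 * n : ℕ)) ∨
    ∃ s V V', Tracks e M x s V V' ∧
      ((∃ n : ℕ, x.2 (e .main) = (2 * n : ℕ)) ∨
        ((∀ W, M.Enters s V W → M.Reachable s₀ U s W) ∧
          x.2 (e .main) = (2 * (c * ∑ j, V j + M.gain s ⬝ᵥ V') + 1 : ℕ)))

theorem Tracks.config_nil : Tracks e M ((M.cra e s₀ U).config []) s₀ U 0 := by
  refine ⟨?_, ?_, fun t => ?_, fun t => ?_⟩
  · have : residues m (0 : J → ℕ) = 0 := by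
      funext j
      simp [residues]
    rw [this]
    rfl
  all_goals simp [NatCRA.config, cra, initReg]

theorem config_nil_main : ((M.cra e s₀ U).config []).2 (e .main) =
    (2 * (c * ∑ j, U j + M.gain s₀ ⬝ᵥ 0) + 1 : ℕ) := by
  simp [NatCRA.config, cra, initReg]

theorem invariant_config (w : List (Letter J)) :
    M.Invariant e s₀ U ((M.cra e s₀ U).config w) := by
  classical
  induction w using List.reverseRecOn with
  | nil =>
    exact .inr ⟨s₀, U, 0, Tracks.config_nil, .inr ⟨fun W hW => .start hW, config_nil_main⟩⟩
  | append_singleton w a ih =>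
    rw [NatCRA.config_append_singleton]
    generalize (M.cra e s₀ U).config w = x at ih ⊢
    rcases ih with ⟨hx, n, hn⟩ | ⟨s, V, V', hT, hmain⟩
    · refine .inl ⟨by simp [NatCRA.next, cra, hx, craStep], n + 1, ?_⟩
      rw [next_cra_snd_of_ne_sep x _ (.inl hx), hn, hx, ← Nat.cast_add]
      rfl
    · cases a with
      | unit j =>
        obtain ⟨hT', hmain'⟩ := hT.unit (s₀ := s₀) (U := U) j
        refine .inr ⟨s, V, _, hT', ?_⟩
        rw [hmain']
        rcases hmain with ⟨n, hn⟩ | ⟨hR, hn⟩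
        · exact .inl ⟨n + M.gain s j, by rw [hn, ← Nat.cast_add, mul_add]⟩
        · refine .inr ⟨hR, ?_⟩
          rw [hn, ← Nat.cast_add, dotProduct_add, dotProduct_single_one]
          congr 1
          ring
      | sep =>
        cases hs : M.next s (residues m V') with
        | none =>
          refine .inl ⟨by simp [NatCRA.next, cra, hT.state, craStep, hs], 0, ?_⟩
          rw [next_cra_snd, hT.state, mul_zero, ← add_zero ((0 : ℕ) : ℕ∞), Nat.cast_zero,
            ← hT.idle]
          convert MinExpr.eval_ofReg_single e x.2 .idle 0 using 2
          · simp [regUpdate, increment]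
          · exact hT.idle
        | some s' =>
          refine .inr ⟨s', V', 0, hT.sep hs, ?_⟩
          rw [next_cra_sep_main hT.state]
          have := even_or_enters hT.old (hmain.imp_right And.right)
          rcases this with h | ⟨hE, hmin, hodd⟩
          · exact .inl h
          · rcases hmain with ⟨n, hn⟩ | ⟨hR, -⟩
            · rw [hn, Nat.cast_inj] at hodd
              omega
            · exact .inr ⟨fun W hW => (hR V' hE).step ⟨hs, hW⟩, by simp [hmin, cost]⟩
      | kill =>
        refine .inl ⟨by simp [NatCRA.next, cra, hT.state, craStep], 0, ?_⟩
        rw [next_cra_snd_of_ne_sep x _ (.inr (by simp)), hT.idle, hT.state]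
        rfl

theorem even_or_reachable_of_value {w : List (Letter J)} {v : ℕ}
    (h : (M.cra e s₀ U).value w = v) :
    Even v ∨ ∃ s V, M.Reachable s₀ U s V ∧ v = cost c V := by
  rcases invariant_config (M := M) (e := e) (s₀ := s₀) (U := U) w with
    ⟨hx, n, hn⟩ | ⟨s, V, V', hT, hmain⟩
  · rw [value_cra_of_none hx, hn, Nat.cast_inj] at h
    exact .inl ⟨n, by omega⟩
  · rw [value_cra_of_some hT.state] at h
    rcases even_or_enters hT.old (hmain.imp_right And.right) with ⟨n, hn⟩ | ⟨hE, hmin, hodd⟩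
    · rw [hn, Nat.cast_inj] at h
      exact .inl ⟨n, by omega⟩
    · rcases hmain with ⟨n, hn⟩ | ⟨hR, -⟩
      · rw [hn, Nat.cast_inj] at hodd
        omega
      · rw [hmin, Nat.cast_inj] at h
        exact .inr ⟨s, V', hR V' hE, h.symm⟩

/-! ### Even numbers and costs of reachable vectors are values -/

/-- The current block can be extended by any vector without losing track of the run. -/
theorem exists_config_append {w : List (Letter J)} {s : S} {V V' : J → ℕ}
    (hT : Tracks e M ((M.cra e s₀ U).config w) s V V')
    (hmain : ((M.cra e s₀ U).config w).2 (e .main) =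
      (2 * (c * ∑ j, V j + M.gain s ⬝ᵥ V') + 1 : ℕ)) (W : J → ℕ) :
    ∃ w', Tracks e M ((M.cra e s₀ U).config w') s V (V' + W) ∧
      ((M.cra e s₀ U).config w').2 (e .main) =
        (2 * (c * ∑ j, V j + M.gain s ⬝ᵥ (V' + W)) + 1 : ℕ) := by
  classical
  induction hN : ∑ j, W j generalizing W with
  | zero =>
    obtain rfl : W = 0 := by
      funext j
      exact Finset.sum_eq_zero_iff.1 hN j (Finset.mem_univ j)
    exact ⟨w, by simpa using hT, by simpa using hmain⟩
  | succ N ih =>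
    obtain ⟨j, -, hj⟩ := Finset.exists_ne_zero_of_sum_ne_zero (hN.trans_ne N.succ_ne_zero)
    have hW : W = (W - Pi.single j 1) + Pi.single j 1 := by
      refine (tsub_add_cancel_of_le fun i => ?_).symm
      by_cases hi : i = j
      · subst hi
        simpa using Nat.one_le_iff_ne_zero.2 hj
      · simp [hi]
    obtain ⟨w', hT', hmain'⟩ := ih (W - Pi.single j 1) (by
      rw [hW] at hN
      simp only [Pi.add_apply, Finset.sum_add_distrib, Finset.sum_pi_single',
        Finset.mem_univ, if_true] at hN
      omega)
    -- The last letter read is `unit j`.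
    rw [hW, ← add_assoc]
    refine ⟨w' ++ [.unit j], ?_, ?_⟩
    · rw [NatCRA.config_append_singleton]
      exact (hT'.unit j).1
    · rw [NatCRA.config_append_singleton, (hT'.unit j).2, hmain', ← Nat.cast_add,
        dotProduct_add _ _ (Pi.single j 1), dotProduct_single_one]
      congr 1
      ring

theorem Tracks.minCompared_eq {x : Option (S × (J → ZMod m)) × (Fin k → ℕ∞)} {s : S}
    {V V' : J → ℕ} (hT : Tracks e M x s V V') (hE : M.Enters s V V')
    (hmain : x.2 (e .main) = (2 * (c * ∑ j, V j + M.gain s ⬝ᵥ V') + 1 : ℕ)) :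
    minCompared e x.2 = cost c V' := by
  rw [minCompared_eq_main, hmain, hE.mul_sum_add_gain, cost]
  intro t
  rw [hmain, hT.old, Nat.cast_le]
  have := (tests_iff s V V').2 hE t
  omega

theorem Reachable.exists_config {s : S} {V' : J → ℕ} (h : M.Reachable s₀ U s V') :
    ∃ w V, Tracks e M ((M.cra e s₀ U).config w) s V V' ∧ M.Enters s V V' ∧
      ((M.cra e s₀ U).config w).2 (e .main) =
        (2 * (c * ∑ j, V j + M.gain s ⬝ᵥ V') + 1 : ℕ) := by
  induction h with
  | @start V hV =>
    obtain ⟨w, h1, h2⟩ := exists_config_append Tracks.config_nil config_nil_main V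
    rw [zero_add] at h1 h2
    exact ⟨w, U, h1, hV, h2⟩
  | @step s V s' V' _ hs ih =>
    obtain ⟨w, V₁, hT, hE, hmain⟩ := ih
    have h1 : Tracks e M ((M.cra e s₀ U).config (w ++ [.sep])) s' V 0 := by
      rw [NatCRA.config_append_singleton]
      exact hT.sep hs.1
    obtain ⟨w', h1, h2⟩ := exists_config_append h1 (by
      rw [NatCRA.config_append_singleton, next_cra_sep_main hT.state, hT.minCompared_eq hE hmain]
      simp [cost]) V'
    rw [zero_add] at h1 h2
    exact ⟨w', V, h1, hs.2, h2⟩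

theorem exists_value_eq_two_mul (n : ℕ) : ∃ w, (M.cra e s₀ U).value w = (2 * n : ℕ) := by
  have h : ∀ n, ((M.cra e s₀ U).config (.kill :: List.replicate n .kill)).1 = none ∧
      ((M.cra e s₀ U).config (.kill :: List.replicate n .kill)).2 (e .idle) =
        (2 * n : ℕ) := by
    intro n
    induction n with
    | zero =>
      have hT : Tracks e M ((M.cra e s₀ U).config []) s₀ U 0 := Tracks.config_nil
      rw [List.replicate_zero, ← List.nil_append [Letter.kill],
        NatCRA.config_append_singleton]
      refine ⟨by simp [NatCRA.next, cra, craStep], ?_⟩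
      rw [next_cra_snd_of_ne_sep _ _ (.inr (by simp)), hT.idle, hT.state]
      rfl
    | succ n ih =>
      rw [List.replicate_succ', ← List.cons_append, NatCRA.config_append_singleton]
      refine ⟨by simp [NatCRA.next, cra, craStep], ?_⟩
      rw [next_cra_snd_of_ne_sep _ _ (.inl ih.1), ih.2, ih.1, ← Nat.cast_add]
      rfl
  exact ⟨_, (value_cra_of_none (h n).1).trans (h n).2⟩

theorem image_cra : (M.cra e s₀ U).image =
    {v | Even v} ∪ {v | ∃ s V, M.Reachable s₀ U s V ∧ v = cost c V} := by
  ext v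
  constructor
  · rintro ⟨w, hw⟩
    exact even_or_reachable_of_value hw
  · rintro (⟨n, rfl⟩ | ⟨s, V, hR, rfl⟩)
    · rw [← two_mul]
      exact exists_value_eq_two_mul n
    · obtain ⟨w, V₁, hT, hE, hmain⟩ := hR.exists_config (e := e)
      exact ⟨w, (value_cra_of_some hT.state).trans (hT.minCompared_eq hE hmain)⟩

end LinearMachine

/-! ### Semilinearity of the image means halting of the machine -/

namespace LinearMachine

variable {S J : Type} [Fintype J] {c m k : ℕ} {M : LinearMachine S J c m}
  {e : Reg J ≃ Fin k} {s₀ : S} {U V₀ : J → ℕ}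

open Classical in
/-- The transition function of a linear machine. -/
noncomputable def stepFun (M : LinearMachine S J c m) (x : S × (J → ℕ)) :
    Option (S × (J → ℕ)) :=
  if h : ∃ y, M.Step x y then some h.choose else none

theorem mem_stepFun {x y : S × (J → ℕ)} : y ∈ M.stepFun x ↔ M.Step x y := by
  unfold stepFun
  constructor
  · intro h
    split_ifs at h with hy
    · rw [← Option.some.inj h]
      exact hy.choose_spec
    · simp at h
  · intro h
    have hy : ∃ y, M.Step x y := ⟨y, h⟩
    rw [dif_pos hy, hy.choose_spec.unique h]
    rfl

theorem reachable_iff (hU : M.Enters s₀ U V₀) {s : S} {V : J → ℕ} :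
    M.Reachable s₀ U s V ↔ StateTransition.Reaches M.stepFun (s₀, V₀) (s, V) := by
  constructor
  · intro h
    induction h with
    | start hV => rw [hU.unique hV]; exact .refl
    | step _ hs ih => exact ih.tail (mem_stepFun.2 hs)
  · intro h
    generalize hx : (s, V) = x at h
    induction h generalizing s V with
    | refl => obtain ⟨rfl, rfl⟩ := Prod.mk.inj hx; exact .start hU
    | @tail y z _ hs ih =>
      subst hx
      exact (ih (s := y.1) (V := y.2) rfl).step (mem_stepFun.1 hs)

theorem image_cra_eq_image (hU : M.Enters s₀ U V₀) : (M.cra e s₀ U).image =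
    {v | Even v} ∪
      (fun x => cost c x.2) '' {x | StateTransition.Reaches M.stepFun (s₀, V₀) x} := by
  rw [image_cra]
  congr 1
  ext v
  constructor
  · rintro ⟨s, V, hR, rfl⟩
    exact ⟨(s, V), (reachable_iff hU).1 hR, rfl⟩
  · rintro ⟨⟨s, V⟩, hR, rfl⟩
    exact ⟨s, V, (reachable_iff hU).2 hR, rfl⟩

theorem finite_reaches_of_dom {σ : Type} {f : σ → Option σ} {a : σ}
    (h : (StateTransition.eval f a).Dom) : {x | StateTransition.Reaches f a x}.Finite := by
  obtain ⟨b, hb⟩ := Part.dom_iff_mem.1 h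
  obtain ⟨hab, hfb⟩ := StateTransition.mem_eval.1 hb
  clear h hb
  induction hab using Relation.ReflTransGen.head_induction_on with
  | refl =>
    refine (Set.finite_singleton b).subset fun x hx => ?_
    rcases Relation.ReflTransGen.cases_head hx with rfl | ⟨y, hy, -⟩
    · rfl
    · simp [hfb] at hy
  | @head a a' haa' _ ih =>
    refine (ih.insert a).subset fun x hx => ?_
    rcases Relation.ReflTransGen.cases_head hx with rfl | ⟨y, hy, hyx⟩
    · exact .inl rfl
    · rw [Option.mem_unique hy haa'] at hyx
      exact .inr hyx

theorem sum_le_of_reaches (hc : 0 < c) {x y : S × (J → ℕ)}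
    (h : StateTransition.Reaches M.stepFun x y) : ∑ j, x.2 j ≤ ∑ j, y.2 j := by
  induction h with
  | refl => exact le_rfl
  | tail _ hs ih => have := (mem_stepFun.1 hs).2.two_mul_sum_le hc; omega

theorem two_mul_sum_le_of_reaches (hc : 0 < c) {x y : S × (J → ℕ)}
    (h : StateTransition.Reaches M.stepFun x y) (hxy : x ≠ y) :
    2 * ∑ j, x.2 j ≤ ∑ j, y.2 j := by
  rcases Relation.ReflTransGen.cases_head h with rfl | ⟨z, hz, hzy⟩
  · exact (hxy rfl).elim
  · have := (mem_stepFun.1 hz).2.two_mul_sum_le hc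
    have := sum_le_of_reaches hc hzy
    omega

theorem exists_reaches_lt_sum (hc : 0 < c) {x : S × (J → ℕ)} (hx : 0 < ∑ j, x.2 j)
    (h : ¬(StateTransition.eval M.stepFun x).Dom) (N : ℕ) :
    ∃ y, StateTransition.Reaches M.stepFun x y ∧ N < ∑ j, y.2 j := by
  induction N with
  | zero => exact ⟨x, .refl, hx⟩
  | succ N ih =>
    obtain ⟨y, hy, hN⟩ := ih
    cases hz : M.stepFun y with
    | none => exact (h (Part.dom_iff_mem.2 ⟨y, StateTransition.mem_eval.2 ⟨hy, hz⟩⟩)).elim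
    | some z =>
      have := (mem_stepFun.1 (Option.mem_def.2 hz)).2.two_mul_sum_le hc
      exact ⟨z, hy.tail hz, by omega⟩

/-- If the machine halts, the image has finitely many odd elements; otherwise the odd elements
grow at least exponentially. -/
theorem isSemilinearSet_image_cra (hc : 0 < c) (hU : M.Enters s₀ U V₀) (hV₀ : 0 < ∑ j, V₀ j) :
    IsSemilinearSet (M.cra e s₀ U).image ↔
      (StateTransition.eval M.stepFun (s₀, V₀)).Dom := by
  rw [image_cra_eq_image hU]
  constructor
  · intro hs
    by_contra hdom
    obtain ⟨k, p, hp, hper⟩ := Nat.isSemilinearSet_iff_ultimately_periodic.1 hs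
    obtain ⟨x, hx, hlt⟩ := exists_reaches_lt_sum hc hV₀ hdom (k + p)
    have hcx : ∑ j, x.2 j ≤ c * ∑ j, x.2 j := Nat.le_mul_of_pos_left _ hc
    -- Two periods lead from the odd number `cost c x.2` to another odd number.
    have hmem := (hper _ (by simp only [cost]; omega)).1
      ((hper (cost c x.2) (by simp only [cost]; omega)).1 (.inr ⟨x, hx, rfl⟩))
    rcases hmem with ⟨n, hn⟩ | ⟨y, hy, hxy⟩
    · simp only [cost] at hn
      omega
    · have hsum : c * ∑ j, y.2 j = c * ∑ j, x.2 j + p := by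
        simp only [cost] at hxy
        omega
      have hne : x ≠ y := by
        rintro rfl
        omega
      rcases StateTransition.reaches_total hx hy with h | h
      · have := Nat.mul_le_mul_left c (two_mul_sum_le_of_reaches hc h hne)
        rw [hsum, mul_left_comm] at this
        omega
      · have := Nat.mul_le_mul_left c (sum_le_of_reaches hc h)
        omega
  · intro h
    refine .union ?_ (.of_finite ((finite_reaches_of_dom h).image _))
    rw [Nat.isSemilinearSet_iff_ultimately_periodic]
    exact ⟨0, 2, two_pos, fun x _ => by simp [Nat.even_add]⟩

end LinearMachine

/-! ### Stack machines as linear machines -/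

namespace LinearMachine

/-- The operations on stacks: popping names the symbol that is removed. -/
inductive StackOp (K Γ : Type)
  | nop
  | push (k : K) (a : Γ)
  | pop (k : K) (a : Γ)
  deriving Fintype

variable {K Γ : Type} (d : Γ ↪ Fin 4)

/-- The number with base `5` digits `d a + 1`, for the symbols `a` of the list, the first symbol
being the least significant digit. -/
def encodeStack : List Γ → ℕ
  | [] => 0
  | a :: l => (d a + 1) + 5 * encodeStack l

/-- The vector that represents the contents `S` of the stacks at scale `Z`. The coordinate `none`
holds the scale itself. -/
def stackVec (Z : ℕ) (S : K → List Γ) : Option K → ℕ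
  | none => Z
  | some k => Z * encodeStack d (S k)

/-! ### The control of a stack machine -/

open Turing TM2

variable {Λ σ : Type}

open Classical in
/-- The top symbol of a stack, read off the residues modulo `5`. -/
noncomputable def top (ρ : Option K → ZMod 5) (k : K) : Option Γ :=
  if h : ∃ a, ρ (some k) = ((d a + 1 : ℕ) : ZMod 5) then some h.choose else none

theorem cast_digit_injective {a b : Γ}
    (h : ((d a + 1 : ℕ) : ZMod 5) = ((d b + 1 : ℕ) : ZMod 5)) : a = b := by
  rw [ZMod.natCast_eq_natCast_iff'] at h
  have := (d a).isLt
  have := (d b).isLt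
  exact d.injective (Fin.ext (by omega))

theorem top_residues {Z : ℕ} (hZ : Z % 5 = 1) (S : K → List Γ) (k : K) :
    top d (residues 5 (stackVec d Z S)) k = (S k).head? := by
  have hZ' : (Z : ZMod 5) = 1 := by
    rw [← Nat.cast_one, ZMod.natCast_eq_natCast_iff', hZ]
  have h : residues 5 (stackVec d Z S) (some k) = (encodeStack d (S k) : ZMod 5) := by
    simp [residues, stackVec, hZ']
  have h5 : (5 : ZMod 5) = 0 := rfl
  unfold top
  rw [h]
  cases S k with
  | nil =>
    rw [dif_neg]
    · rfl
    · rintro ⟨a, ha⟩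
      rw [ZMod.natCast_eq_natCast_iff'] at ha
      have := (d a).isLt
      simp only [encodeStack] at ha
      omega
  | cons a l =>
    have ha : (encodeStack d (a :: l) : ZMod 5) = ((d a + 1 : ℕ) : ZMod 5) := by
      simp only [encodeStack, Nat.cast_add, Nat.cast_mul, Nat.cast_ofNat, h5, zero_mul, add_zero]
    have hex : ∃ b, (encodeStack d (a :: l) : ZMod 5) = ((d b + 1 : ℕ) : ZMod 5) := ⟨a, ha⟩
    rw [dif_pos hex, List.head?_cons]
    exact congrArg some (cast_digit_injective d (hex.choose_spec.symm.trans ha))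

/-- The control states of the simulation: the last stack operation, the statement that is left to
execute (`none` after halting), and the internal state. -/
abbrev StackControl (K Γ Λ σ : Type) : Type :=
  StackOp K Γ × Option (Stmt (fun _ : K => Γ) Λ σ) × σ

/-- The control state that follows a control state, given the residues of the stack vector. Each
statement, and halting, takes one step. -/
noncomputable def stackNext (T : Λ → Stmt (fun _ : K => Γ) Λ σ) (x : StackControl K Γ Λ σ)
    (ρ : Option K → ZMod 5) : Option (StackControl K Γ Λ σ) :=
  match x with
  | (_, none, _) => none
  | (_, some (.push k f q), v) => some (.push k (f v), some q, v)
  | (_, some (.peek k f q), v) => some (.nop, some q, f v (top d ρ k))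
  | (_, some (.pop k f q), v) =>
    some ((top d ρ k).elim .nop (.pop k), some q, f v (top d ρ k))
  | (_, some (.load f q), v) => some (.nop, some q, f v)
  | (_, some (.branch p q₁ q₂), v) => some (.nop, some (cond (p v) q₁ q₂), v)
  | (_, some (.goto f), v) => some (.nop, some (T (f v)), v)
  | (_, some .halt, v) => some (.nop, none, v)

theorem some_mem_stmts {T : Λ → Stmt (fun _ : K => Γ) Λ σ} {L : Finset Λ} {l : Λ} (hl : l ∈ L) :
    some (T l) ∈ stmts T L := by
  simp only [stmts, Finset.mem_insertNone, Finset.mem_biUnion, Option.mem_def,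
    Option.some.injEq, forall_eq']
  exact ⟨l, hl, stmts₁_self⟩

theorem stackNext_mem_stmts {T : Λ → Stmt (fun _ : K => Γ) Λ σ} {L : Finset Λ}
    (hL : ∀ l ∈ L, SupportsStmt L (T l)) {x y : StackControl K Γ Λ σ}
    {ρ : Option K → ZMod 5} (hx : x.2.1 ∈ stmts T L) (h : stackNext d T x ρ = some y) :
    y.2.1 ∈ stmts T L := by
  obtain ⟨o, q, v⟩ := x
  rcases q with - | q
  · simp [stackNext] at h
  cases q <;> simp only [stackNext, Option.some.injEq] at h <;> subst h
  case push k f q => exact stmts_trans (by simp [stmts₁, stmts₁_self]) hx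
  case peek k f q => exact stmts_trans (by simp [stmts₁, stmts₁_self]) hx
  case pop k f q => exact stmts_trans (by simp [stmts₁, stmts₁_self]) hx
  case load f q => exact stmts_trans (by simp [stmts₁, stmts₁_self]) hx
  case branch p q₁ q₂ =>
    cases p v
    · exact stmts_trans (by simp [stmts₁, stmts₁_self]) hx
    · exact stmts_trans (by simp [stmts₁, stmts₁_self]) hx
  case goto f =>
    simp only [stmts, Finset.mem_insertNone, Finset.mem_biUnion, Option.mem_def,
      Option.some.injEq, forall_eq'] at hx
    obtain ⟨l, hl, hq⟩ := hx
    exact some_mem_stmts (stmts₁_supportsStmt_mono hq (hL l hl) v)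
  case halt => simp [stmts]

theorem finite_stackControl (T : Λ → Stmt (fun _ : K => Γ) Λ σ) (L : Finset Λ)
    [Finite K] [Finite Γ] [Finite σ] :
    Finite {x : StackControl K Γ Λ σ // x.2.1 ∈ stmts T L} := by
  have := Fintype.ofFinite Γ
  have := Fintype.ofFinite K
  refine Finite.of_injective (β := StackOp K Γ × {q // q ∈ stmts T L} × σ)
    (fun x => (x.1.1, ⟨x.1.2.1, x.2⟩, x.1.2.2)) ?_
  rintro ⟨⟨o, q, v⟩, hx⟩ ⟨⟨o', q', v'⟩, hx'⟩ h
  simp only [Prod.mk.injEq, Subtype.mk.injEq] at h ⊢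
  exact h

variable [DecidableEq K]

/-! ### The linear maps of the stack operations -/

/-- The diagonal entries of the matrix of an operation. -/
def StackOp.diag : StackOp K Γ → Option K → ℤ
  | nop, _ => 5
  | push k _, j => if j = some k then 1 else 5
  | pop k _, j => if j = some k then 25 else 5

/-- The entries in the column `none` of the matrix of an operation, besides the diagonal. -/
def StackOp.shift : StackOp K Γ → Option K → ℤ
  | nop, _ => 0
  | push k a, j => if j = some k then -(d a + 1 : ℕ) else 0
  | pop k a, j => if j = some k then 5 * (d a + 1 : ℕ) else 0

/-- `55` times the inverse of an operation followed by a multiplication of the scale by `11`. As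
`11` is `1` modulo `5`, the residues modulo `5` are those of the encoded stacks. -/
def StackOp.mat (o : StackOp K Γ) : Matrix (Option K) (Option K) ℤ := fun j i =>
  (if i = j then o.diag j else 0) + if i = none then o.shift d j else 0

namespace StackOp

variable (o : StackOp K Γ)

theorem diag_pos (j : Option K) : 0 < o.diag j := by
  cases o <;> simp only [diag] <;> (try split_ifs) <;> norm_num

theorem diag_le (j : Option K) : o.diag j ≤ 25 := by
  cases o <;> simp only [diag] <;> (try split_ifs) <;> norm_num

theorem diag_none : o.diag none = 5 := by
  cases o <;> simp [diag]

theorem shift_none : o.shift d none = 0 := by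
  cases o <;> simp [shift]

theorem abs_shift_le (j : Option K) : |o.shift d j| ≤ 20 := by
  rw [abs_le]
  rcases o with - | ⟨k, a⟩ | ⟨k, a⟩
  · simp [shift]
  all_goals
    have := (d a).isLt
    simp only [shift]
    split_ifs <;> omega

theorem abs_mat_le (j i : Option K) : |o.mat d j i| ≤ 25 := by
  unfold mat
  have h := o.abs_shift_le d j
  rcases eq_or_ne i none with rfl | hi
  · by_cases hj : none = j
    · subst hj
      simp [diag_none, shift_none]
    · simp only [if_neg hj, if_true, zero_add]
      linarith
  · rw [if_neg hi, add_zero]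
    split_ifs
    · rw [abs_of_pos (o.diag_pos j)]
      exact o.diag_le j
    · simp

variable [Fintype K]

theorem sum_shift_le : ∑ j, o.shift d j ≤ 20 := by
  rcases o with - | ⟨k, a⟩ | ⟨k, a⟩
  · simp [shift]
  all_goals
    have := (d a).isLt
    simp only [shift, Finset.sum_ite_eq', Finset.mem_univ, if_true]
    omega

theorem sum_mat (i : Option K) :
    ∑ j, o.mat d j i = o.diag i + if i = none then ∑ j, o.shift d j else 0 := by
  simp only [mat, Finset.sum_add_distrib, Finset.sum_ite_eq, Finset.mem_univ, if_true]
  split_ifs <;> simp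

theorem sum_mat_le (i : Option K) : ∑ j, o.mat d j i ≤ 25 := by
  rw [sum_mat]
  split_ifs with h
  · rw [h, diag_none]
    linarith [o.sum_shift_le d]
  · linarith [o.diag_le i]

theorem mat_mulVec (W : Option K → ℤ) (j : Option K) :
    (o.mat d *ᵥ W) j = o.diag j * W j + o.shift d j * W none := by
  simp [mulVec, dotProduct, mat, add_mul, Finset.sum_add_distrib]

theorem mat_injective : Function.Injective (o.mat d *ᵥ ·) := by
  intro W W' h
  replace h : ∀ j, o.diag j * W j + o.shift d j * W none =
      o.diag j * W' j + o.shift d j * W' none := fun j => by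
    rw [← mat_mulVec, ← mat_mulVec]
    exact congrFun h j
  have h0 : W none = W' none := by
    have := h none
    rw [shift_none, zero_mul, zero_mul, add_zero, add_zero] at this
    exact mul_left_cancel₀ (o.diag_pos none).ne' this
  funext j
  have := h j
  rw [h0, add_left_inj] at this
  exact mul_left_cancel₀ (o.diag_pos j).ne' this

end StackOp

/-! ### The linear machine of a stack machine -/

variable [Fintype K]

/-- The linear machine that simulates the program `T` started in labels from `L`. -/
noncomputable def ofStack (T : Λ → Stmt (fun _ : K => Γ) Λ σ) (L : Finset Λ)
    (hL : ∀ l ∈ L, SupportsStmt L (T l)) :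
    LinearMachine {x : StackControl K Γ Λ σ // x.2.1 ∈ stmts T L} (Option K) 55 5 where
  mat x := x.1.1.mat d
  next x ρ := (stackNext d T x.1 ρ).pmap Subtype.mk fun _ h => stackNext_mem_stmts d hL x.2 h
  mat_injective x := x.1.1.mat_injective d
  abs_mat_add_le x i j := by
    have := x.1.1.sum_mat_le d i
    have := x.1.1.abs_mat_le d j i
    push_cast
    linarith
  two_mul_sum_mat_le x i := by
    have := x.1.1.sum_mat_le d i
    push_cast
    linarith

variable {T : Λ → Stmt (fun _ : K => Γ) Λ σ} {L : Finset Λ}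
  {hL : ∀ l ∈ L, SupportsStmt L (T l)}

section

variable {x : {x : StackControl K Γ Λ σ // x.2.1 ∈ stmts T L}} (Z : ℕ) (S : K → List Γ)

theorem enters_nop (hx : x.1.1 = .nop) :
    (ofStack d T L hL).Enters x (stackVec d Z S) (stackVec d (11 * Z) S) := by
  intro j
  simp only [ofStack, hx, StackOp.mat_mulVec]
  cases j <;> simp only [StackOp.diag, StackOp.shift, stackVec] <;> push_cast <;> ring

theorem enters_push {k : K} {a : Γ} (hx : x.1.1 = .push k a) :
    (ofStack d T L hL).Enters x (stackVec d Z S)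
      (stackVec d (11 * Z) (Function.update S k (a :: S k))) := by
  intro j
  simp only [ofStack, hx, StackOp.mat_mulVec]
  rcases j with - | k'
  · simp only [StackOp.diag, StackOp.shift, stackVec, reduceCtorEq, if_false]
    push_cast
    ring
  · by_cases h : k' = k
    · subst h
      simp only [StackOp.diag, StackOp.shift, stackVec, if_true, Function.update_self,
        encodeStack]
      push_cast
      ring
    · simp only [StackOp.diag, StackOp.shift, stackVec, Option.some.injEq, if_neg h,
        Function.update_of_ne h]
      push_cast
      ring

theorem enters_pop {k : K} {a : Γ} {l : List Γ} (hx : x.1.1 = .pop k a) (hS : S k = a :: l) :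
    (ofStack d T L hL).Enters x (stackVec d Z S)
      (stackVec d (11 * Z) (Function.update S k l)) := by
  intro j
  simp only [ofStack, hx, StackOp.mat_mulVec]
  rcases j with - | k'
  · simp only [StackOp.diag, StackOp.shift, stackVec, reduceCtorEq, if_false]
    push_cast
    ring
  · by_cases h : k' = k
    · subst h
      simp only [StackOp.diag, StackOp.shift, stackVec, if_true, Function.update_self, hS,
        encodeStack]
      push_cast
      ring
    · simp only [StackOp.diag, StackOp.shift, stackVec, Option.some.injEq, if_neg h,
        Function.update_of_ne h]
      push_cast
      ring

end

/-- The configurations of the linear machine that represent a configuration of the stack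
machine. -/
def Represents (T : Λ → Stmt (fun _ : K => Γ) Λ σ) (L : Finset Λ)
    (C : Cfg (fun _ : K => Γ) Λ σ)
    (y : {x : StackControl K Γ Λ σ // x.2.1 ∈ stmts T L} × (Option K → ℕ)) : Prop :=
  y.1.1.2 = (C.l.map T, C.var) ∧ ∃ Z, Z % 5 = 1 ∧ y.2 = stackVec d Z C.stk

theorem exists_step {x : {x : StackControl K Γ Λ σ // x.2.1 ∈ stmts T L}} {V : Option K → ℕ}
    {y : StackControl K Γ Λ σ} (h : stackNext d T x.1 (residues 5 V) = some y) :
    ∃ y' : {x : StackControl K Γ Λ σ // x.2.1 ∈ stmts T L}, y'.1 = y ∧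
      ∀ V', (ofStack d T L hL).Enters y' V V' →
        (y', V') ∈ (ofStack d T L hL).stepFun (x, V) :=
  ⟨⟨y, stackNext_mem_stmts d hL x.2 h⟩, rfl, fun V' hE => mem_stepFun.2
    ⟨by simp only [ofStack, h, Option.pmap_some], hE⟩⟩

/-- The linear machine executes a statement of the stack machine. -/
theorem exists_reaches_stepAux (q : Stmt (fun _ : K => Γ) Λ σ) (v : σ) (S : K → List Γ)
    {x : {x : StackControl K Γ Λ σ // x.2.1 ∈ stmts T L}} (hx : x.1.2 = (some q, v)) {Z : ℕ}
    (hZ : Z % 5 = 1) :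
    ∃ y, Represents d T L (stepAux q v S) y ∧
      StateTransition.Reaches₁ (ofStack d T L hL).stepFun (x, stackVec d Z S) y := by
  obtain ⟨⟨o, q', v'⟩, hq⟩ := x
  obtain ⟨rfl, rfl⟩ := Prod.mk.inj hx
  have hZ' : 11 * Z % 5 = 1 := by omega
  have htop := top_residues d hZ S
  induction q generalizing v' S Z o with
  | push k f q ih =>
    obtain ⟨y, hy, hstep⟩ := exists_step (hL := hL) d (x := ⟨_, hq⟩) (V := stackVec d Z S) rfl
    obtain ⟨⟨o', _, _⟩, hq'⟩ := y
    cases hy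
    obtain ⟨z, hz, hr⟩ := ih (Function.update S k (f v' :: S k)) hZ' _ _ hq' rfl (by omega)
      (top_residues d hZ' _)
    exact ⟨z, hz, hr.head (hstep _ (enters_push d Z S rfl))⟩
  | peek k f q ih =>
    obtain ⟨y, hy, hstep⟩ := exists_step (hL := hL) d (x := ⟨_, hq⟩) (V := stackVec d Z S) rfl
    obtain ⟨⟨o', _, _⟩, hq'⟩ := y
    cases hy
    obtain ⟨z, hz, hr⟩ := ih S hZ' _ _ hq' rfl (by omega) (top_residues d hZ' _)
    rw [htop] at hz
    exact ⟨z, hz, hr.head (hstep _ (enters_nop d Z S rfl))⟩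
  | pop k f q ih =>
    obtain ⟨y, hy, hstep⟩ := exists_step (hL := hL) d (x := ⟨_, hq⟩) (V := stackVec d Z S) rfl
    obtain ⟨⟨o', _, _⟩, hq'⟩ := y
    obtain ⟨rfl, h2⟩ := Prod.mk.inj hy
    cases h2
    obtain ⟨z, hz, hr⟩ := ih (Function.update S k (S k).tail) hZ' _ _ hq' rfl (by omega)
      (top_residues d hZ' _)
    have hE := hstep (stackVec d (11 * Z) (Function.update S k (S k).tail)) (by
      cases hS : S k with
      | nil =>
        rw [List.tail_nil, ← hS, Function.update_eq_self]
        exact enters_nop d Z S (by simp [htop, hS])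
      | cons a l => exact enters_pop d Z S (a := a) (by simp [htop, hS]) hS)
    refine ⟨z, ?_, hr.head hE⟩
    rw [htop] at hz
    exact hz
  | load f q ih =>
    obtain ⟨y, hy, hstep⟩ := exists_step (hL := hL) d (x := ⟨_, hq⟩) (V := stackVec d Z S) rfl
    obtain ⟨⟨o', _, _⟩, hq'⟩ := y
    cases hy
    obtain ⟨z, hz, hr⟩ := ih S hZ' _ _ hq' rfl (by omega) (top_residues d hZ' _)
    exact ⟨z, hz, hr.head (hstep _ (enters_nop d Z S rfl))⟩
  | branch p q₁ q₂ ih₁ ih₂ =>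
    obtain ⟨y, hy, hstep⟩ := exists_step (hL := hL) d (x := ⟨_, hq⟩) (V := stackVec d Z S) rfl
    obtain ⟨⟨o', _, _⟩, hq'⟩ := y
    cases hy
    have hE := hstep _ (enters_nop d Z S rfl)
    rw [stepAux]
    revert hq' hE
    cases p v' <;> intro hq' _ hE
    · obtain ⟨z, hz, hr⟩ := ih₂ S hZ' _ _ hq' rfl (by omega) (top_residues d hZ' _)
      exact ⟨z, hz, hr.head hE⟩
    · obtain ⟨z, hz, hr⟩ := ih₁ S hZ' _ _ hq' rfl (by omega) (top_residues d hZ' _)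
      exact ⟨z, hz, hr.head hE⟩
  | goto f =>
    obtain ⟨y, hy, hstep⟩ := exists_step (hL := hL) d (x := ⟨_, hq⟩) (V := stackVec d Z S) rfl
    exact ⟨_, ⟨by rw [hy]; rfl, _, hZ', rfl⟩, .single (hstep _ (enters_nop d Z S (by rw [hy])))⟩
  | halt =>
    obtain ⟨y, hy, hstep⟩ := exists_step (hL := hL) d (x := ⟨_, hq⟩) (V := stackVec d Z S) rfl
    exact ⟨_, ⟨by rw [hy]; rfl, _, hZ', rfl⟩, .single (hstep _ (enters_nop d Z S (by rw [hy])))⟩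

theorem respects_stack :
    StateTransition.Respects (step T) (ofStack d T L hL).stepFun (Represents d T L) := by
  rintro ⟨l, v, S⟩ ⟨x, V⟩ ⟨hx, Z, hZ, hV⟩
  dsimp only at hx hV
  subst hV
  cases l with
  | some l => exact exists_reaches_stepAux d (T l) v S hx hZ
  | none =>
    rw [step]
    refine Option.eq_none_iff_forall_not_mem.2 fun y hy => ?_
    obtain ⟨⟨o, q, v'⟩, hq⟩ := x
    obtain ⟨rfl, rfl⟩ := Prod.mk.inj hx
    have := (mem_stepFun.1 hy).1
    simp [ofStack, stackNext] at this

end LinearMachine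

/-! ### A computable family of automata -/

section Primrec

theorem Primrec.nat_finset_sum {ι : Type} (s : Finset ι) {f : ι → ℕ → ℕ}
    (hf : ∀ i, Primrec (f i)) : Primrec fun n => ∑ i ∈ s, f i n := by
  classical
  induction s using Finset.induction_on with
  | empty => simpa using Primrec.const 0
  | insert a s ha ih =>
    simp only [Finset.sum_insert ha]
    exact Primrec.nat_add.comp (hf a) ih

theorem Primrec.nat_dotProduct {ι : Type} [Fintype ι] (v : ι → ℕ) {U : ℕ → ι → ℕ}
    (hU : ∀ i, Primrec fun n => U n i) : Primrec fun n => v ⬝ᵥ U n :=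
  Primrec.nat_finset_sum Finset.univ fun i => Primrec.nat_mul.comp (Primrec.const _) (hU i)

end Primrec

namespace LinearMachine

theorem primrec_initReg {J : Type} [Fintype J] (c : ℕ) {U : ℕ → J → ℕ}
    (hU : ∀ i, Primrec fun n => U n i) (r : Reg J) : Primrec fun n => initReg c (U n) r := by
  cases r with
  | main =>
    exact Primrec.succ.comp (Primrec.nat_mul.comp (Primrec.const 2) (Primrec.nat_mul.comp
      (Primrec.const c) (Primrec.nat_finset_sum Finset.univ hU)))
  | idle => exact Primrec.const 0
  | old t =>
    exact Primrec.nat_add.comp (Primrec.nat_mul.comp (Primrec.const 2)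
      (Primrec.nat_dotProduct _ hU)) (Primrec.const 2)
  | cur t => exact Primrec.const 2

/-- If the image of the automaton of a linear machine can be decided to be semilinear, then it can
be decided whether the machine halts on a primitive recursive sequence of inputs. -/
theorem computablePred_dom {S J : Type} [Finite S] [Fintype J] {c m : ℕ} [NeZero m]
    (M : LinearMachine S J c m) (hc : 0 < c) (s₀ : S) {U V₀ : ℕ → J → ℕ}
    (hU : ∀ i, Primrec fun n => U n i) (hE : ∀ n, M.Enters s₀ (U n) (V₀ n))
    (hV₀ : ∀ n, 0 < ∑ j, V₀ n j) {D : NatCRACode →. Bool} (hD : Partrec D)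
    (hdec : ∀ (m n k : ℕ) (C : NatCRA (Fin m) (Fin n) k), C.Copyless →
      ∃ b ∈ D C.code, (b = true ↔ IsSemilinearSet C.image)) :
    ComputablePred fun n => (StateTransition.eval M.stepFun (s₀, V₀ n)).Dom := by
  classical
  obtain ⟨nA, ⟨f⟩⟩ := Finite.exists_equiv_fin (Letter J)
  obtain ⟨nQ, ⟨g⟩⟩ := Finite.exists_equiv_fin (Option (S × (J → ZMod m)))
  obtain ⟨k, ⟨e⟩⟩ := Finite.exists_equiv_fin (Reg J)
  let C : ℕ → NatCRA (Fin nA) (Fin nQ) k := fun n => (M.cra e s₀ (U n)).reindex f g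
  have hC : Computable fun n => (C n).code :=
    NatCRA.computable_code_init C (fun i n => initReg c (U n) (e.symm i))
      (fun i => primrec_initReg c hU _) fun x => rfl
  choose b hb hbs using fun n => hdec _ _ _ (C n) ((M.copyless_cra e s₀ (U n)).reindex f g)
  have hbc : Computable b := (hD.comp hC).of_eq_tot hb
  refine ComputablePred.computable_iff.2 ⟨b, hbc, funext fun n => propext ?_⟩
  rw [hbs n, NatCRA.image_reindex, isSemilinearSet_image_cra hc (hE n) (hV₀ n)]

end LinearMachine

/-! ### Inputs of Turing machines -/

open Turing PartrecToTM2 LinearMachine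

instance : Fintype K' :=
  ⟨{K'.main, K'.rev, K'.aux, K'.stack}, fun k => by cases k <;> simp⟩

/-- A numbering of the stack symbols. -/
noncomputable def digit : Γ' ↪ Fin 4 := (Fintype.equivFinOfCardEq (by decide)).toEmbedding

theorem trNat_two_mul {n : ℕ} (hn : n ≠ 0) : trNat (2 * n) = Γ'.bit0 :: trNat n := by
  have h : ((2 * n : ℕ) : Num) = (n : Num).bit0 := by
    rw [two_mul, Nat.cast_add, Num.bit0_of_bit0]
  unfold trNat
  rw [h]
  cases h' : (n : Num) with
  | zero => exact (hn ((Num.to_of_nat n).symm.trans (congrArg (fun x : Num => (x : ℕ)) h'))).elim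
  | pos p => rfl

theorem trNat_two_mul_add_one (n : ℕ) : trNat (2 * n + 1) = Γ'.bit1 :: trNat n := by
  have h : ((2 * n + 1 : ℕ) : Num) = (n : Num).bit1 := by
    rw [two_mul, Nat.cast_add, Nat.cast_add, Nat.cast_one, Num.bit1_of_bit1]
  unfold trNat
  rw [h]
  cases (n : Num) <;> rfl

theorem encodeStack_trList (n : ℕ) (hn : n ≠ 0) : encodeStack digit (trList [n]) =
    (digit (if n % 2 = 1 then .bit1 else .bit0) + 1) +
      5 * encodeStack digit (trList [n / 2]) := by
  rcases Nat.even_or_odd' n with ⟨m, rfl | rfl⟩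
  · have h : 2 * m / 2 = m := by omega
    have h' : ¬2 * m % 2 = 1 := by omega
    rw [h, if_neg h', trList, trNat_two_mul (by omega)]
    rfl
  · have h : (2 * m + 1) / 2 = m := by omega
    have h' : (2 * m + 1) % 2 = 1 := by omega
    rw [h, if_pos h', trList, trNat_two_mul_add_one]
    rfl

theorem primrec_encodeStack_trList : Primrec fun n => encodeStack digit (trList [n]) := by
  let y := fun n => encodeStack digit (trList [n])
  let g : Unit → List ℕ → Option ℕ := fun _ l =>
    if l.length = 0 then some (y 0) else
      (l[l.length / 2]?).map fun z =>
        ((if l.length % 2 = 1 then (digit .bit1 : ℕ) else digit .bit0) + 1) + 5 * z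
  have hlen : Primrec fun p : Unit × List ℕ => p.2.length := Primrec.list_length.comp .snd
  have hg : Primrec₂ g := by
    refine Primrec.ite (Primrec.eq.comp hlen (.const 0)) (.const _) (Primrec.option_map
      (Primrec.list_getElem?.comp .snd (Primrec.nat_div.comp hlen (.const 2))) ?_)
    exact Primrec.nat_add.comp (Primrec.succ.comp (Primrec.ite (Primrec.eq.comp
      (Primrec.nat_mod.comp (hlen.comp .fst) (.const 2)) (.const 1)) (.const _) (.const _)))
      (Primrec.nat_mul.comp (.const 5) .snd)
  have h : Primrec₂ fun (_ : Unit) n => y n := Primrec.nat_strong_rec _ hg fun _ n => by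
    simp only [g, List.length_map, List.length_range]
    split_ifs with h0 h2
    · rw [h0]
    all_goals
      have hlt : n / 2 < n := by omega
      simp [-trList, hlt, y, encodeStack_trList n h0, h2]
  exact h.comp (.const ()) .id

/-! ### Undecidability -/

/-- There is a single program whose halting on an input is undecidable: it runs its input, as the
code of a program, on `0`. -/
theorem exists_toPartrec_code_not_computable :
    ∃ c : ToPartrec.Code, ¬ComputablePred fun n : ℕ => (c.eval [n]).Dom := by
  let f : ℕ →. ℕ := fun n => (Denumerable.ofNat Nat.Partrec.Code n).eval 0
  have hf : Partrec f :=
    Nat.Partrec.Code.eval_part.comp (Computable.ofNat _) (Computable.const 0)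
  obtain ⟨c, hc⟩ := ToPartrec.Code.exists_code (Nat.Partrec'.part_iff₁.2 hf)
  refine ⟨c, fun h => ComputablePred.halting_problem 0 ?_⟩
  have hdom : ∀ n, (c.eval [n]).Dom ↔ (f n).Dom := fun n => by
    have := hc (n ::ᵥ List.Vector.nil)
    rw [List.Vector.head_cons] at this
    change c.eval [n] = _ at this
    rw [this]
    rfl
  obtain ⟨b, hb, hbe⟩ := ComputablePred.computable_iff.1 h
  refine ComputablePred.computable_iff.2
    ⟨_, hb.comp Computable.encode, funext fun x => propext ?_⟩
  have := congrFun hbe (Encodable.encode x)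
  rw [← this, hdom]
  simp [f]

/-- There is no algorithm that, given a copyless cost register automaton over `ℕ ∪ {∞}`, decides
whether its image is semilinear. -/
theorem mainTheorem3 :
    ¬ ∃ D : NatCRACode →. Bool, Partrec D ∧
      ∀ (m n k : ℕ) (C : NatCRA (Fin m) (Fin n) k), C.Copyless →
        ∃ b ∈ D C.code, (b = true ↔ IsSemilinearSet C.image) := by
  rintro ⟨D, hD, hdec⟩
  obtain ⟨c, hc⟩ := exists_toPartrec_code_not_computable
  have hL := (tr_supports c .halt).2
  have hfin := finite_stackControl (K := K') (Γ := Γ') tr (codeSupp c .halt)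
  have hstart : some (tr (trNormal c .halt)) ∈ TM2.stmts tr (codeSupp c .halt) :=
    some_mem_stmts (tr_supports c .halt).1
  let S : ℕ → K' → List Γ' := fun n => K'.elim (trList [n]) [] [] []
  have hU : ∀ i, Primrec fun n => stackVec digit 1 (S n) i := by
    rintro (- | k)
    · exact .const 1
    · cases k
      · exact (Primrec.nat_mul.comp (.const 1) primrec_encodeStack_trList)
      all_goals exact .const _
  refine hc ((computablePred_dom (ofStack digit tr _ hL) (by norm_num)
    ⟨(.nop, some (tr (trNormal c .halt)), none), hstart⟩ hU
    (fun n => enters_nop digit 1 (S n) rfl) (fun n => ?_) hD hdec).of_eq fun n => ?_)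
  · exact Finset.sum_pos' (fun _ _ => Nat.zero_le _) ⟨none, Finset.mem_univ _, by simp [stackVec]⟩
  · have h := StateTransition.tr_eval_dom (respects_stack digit (hL := hL))
      (a₁ := init c [n]) (a₂ := (⟨(.nop, some (tr (trNormal c .halt)), none), hstart⟩,
        stackVec digit (11 * 1) (S n))) ⟨rfl, 11 * 1, by norm_num, rfl⟩
    rw [h, tr_eval]
    rfl
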